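/- Let $p$ be a prime and let $G$ be a $p$-adic analytic group, i.e. a topological group which carries the structure of a (finite-dimensional) analytic manifold over $\mathbb{Q}_p$ for which multiplication and inversion are analytic maps. Let $k$ be a field of positive characteristic (not necessarily equal to $p$). A representation of $G$ on a $k$-vector space $V$ (a homomorphism from the abstract group $G$ to $\mathrm{GL}_k(V)$) is called *smooth* if the action map $G\times V\to V$ is continuous when $V$ carries the discrete topology. For an arbitrary representation $V$ of $G$ over $k$, the smooth part of $V$ is the subrepresentation $$V^{\mathrm{sm}}=\bigcup_{K} V^K,\qquad V^K=\{v\in V : xv=v \text{ for all } x\in K\},$$ where $K$ runs through the compact open subgroups of $G$. A morphism $f\colon V\to W$ of representations restricts to a morphism $f^{\mathrm{sm}}\colon V^{\mathrm{sm}}\to W^{\mathrm{sm}}$. Let $f\colon V\to W$ be a surjective morphism of representations of $G$ over $k$ such that the representation $\ker(f)$ is smooth. Then $f^{\mathrm{sm}}\colon V^{\mathrm{sm}}\to W^{\mathrm{sm}}$ is surjective. -/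

import Mathlib

open scoped Manifold ContDiff

/-- A `p`-adic analytic group has a compact open subgroup. -/
theorem LieGroup.exists_isOpen_isCompact_subgroup {p : ℕ} [Fact p.Prime] {d : ℕ}
    {G : Type*} [Group G] [TopologicalSpace G] [IsTopologicalGroup G]
    [ChartedSpace (Fin d → ℚ_[p]) G] [LieGroup 𝓘(ℚ_[p], Fin d → ℚ_[p]) ω G] :
    ∃ K : Subgroup G, IsOpen (K : Set G) ∧ IsCompact (K : Set G) := by
  let e := chartAt (Fin d → ℚ_[p]) (1 : G)
  have h1 : (1 : G) ∈ e.source := mem_chart_source _ _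
  obtain ⟨r, hr, hre⟩ := Metric.isOpen_iff.1 e.open_target _ (e.map_source h1)
  let B : Set (Fin d → ℚ_[p]) := Metric.closedBall (e 1) (r / 2)
  have hBt : B ⊆ e.target := (Metric.closedBall_subset_ball (by linarith)).trans hre
  have hBo : IsOpen B := IsUltrametricDist.isOpen_closedBall _ (by positivity)
  have hBc : IsCompact B := isCompact_closedBall _ _
  let U : Set G := e.symm '' B
  have hU1 : (1 : G) ∈ U := ⟨e 1, Metric.mem_closedBall_self (by positivity), e.left_inv h1⟩
  have hUo : IsOpen U := e.isOpen_image_symm_of_subset_target hBo hBt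
  have hUc : IsCompact U := hBc.image_of_continuousOn (e.continuousOn_symm.mono hBt)
  obtain ⟨S, hS, hSU⟩ := compact_open_separated_mul_left hUc hUo subset_rfl
  let H : Subgroup G := Subgroup.closure (S ∩ S⁻¹)
  have hT : S ∩ S⁻¹ ∈ nhds (1 : G) := Filter.inter_mem hS (inv_mem_nhds_one G hS)
  have hHo : IsOpen (H : Set G) :=
    Subgroup.isOpen_of_mem_nhds H (Filter.mem_of_superset hT Subgroup.subset_closure)
  have hHU : ∀ x ∈ H, ∀ u ∈ U, x * u ∈ U := by
    intro x hx
    induction hx using Subgroup.closure_induction'' with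
    | mem x hx => exact fun u hu => hSU (Set.mul_mem_mul hx.1 hu)
    | inv_mem x hx => exact fun u hu => hSU (Set.mul_mem_mul hx.2 hu)
    | one => exact fun u hu => by rwa [one_mul]
    | mul x y _ _ hx hy => exact fun u hu => by rw [mul_assoc]; exact hx _ (hy _ hu)
  refine ⟨H, hHo, hUc.of_isClosed_subset (Subgroup.isClosed_of_isOpen H hHo) fun x hx => ?_⟩
  simpa using hHU x hx 1 hU1

namespace Representation

/-- A representation `ρ` of a topological group `G` on `V` is smooth if the action map
`G × V → V` is continuous when `V` carries the discrete topology. -/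
def IsSmooth {k G V : Type*} [CommRing k] [Group G] [TopologicalSpace G]
    [AddCommGroup V] [Module k V] (ρ : Representation k G V) : Prop :=
  letI : TopologicalSpace V := ⊥
  Continuous fun x : G × V => ρ x.1 x.2

/-- The submodule `V^K` of vectors fixed by all elements of the subgroup `K`. -/
def fixedBy {k G V : Type*} [CommRing k] [Group G] [AddCommGroup V] [Module k V]
    (ρ : Representation k G V) (K : Subgroup G) : Submodule k V where
  carrier := {v | ∀ x ∈ K, ρ x v = v}
  add_mem' := fun ha hb x hx => by rw [map_add, ha x hx, hb x hx]
  zero_mem' := fun x _ => map_zero (ρ x)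
  smul_mem' := fun c v hv x hx => by rw [map_smul, hv x hx]

/-- The smooth part `V^sm`: the sum of the subspaces `V^K`, with `K` running through the compact
open subgroups of `G`. As soon as `G` has a compact open subgroup, this is the union of the `V^K`, see
`Representation.coe_smoothPart`; every `p`-adic analytic group has one, see
`LieGroup.exists_isOpen_isCompact_subgroup`. -/
def smoothPart {k G V : Type*} [CommRing k] [Group G] [TopologicalSpace G] [IsTopologicalGroup G]
    [AddCommGroup V] [Module k V] (ρ : Representation k G V) : Subrepresentation ρ where
  toSubmodule := ⨆ (K : Subgroup G) (_ : IsOpen (K : Set G) ∧ IsCompact (K : Set G)), ρ.fixedBy K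
  apply_mem_toSubmodule := by
    intro g
    suffices h : (⨆ (K : Subgroup G) (_ : IsOpen (K : Set G) ∧ IsCompact (K : Set G)),
        ρ.fixedBy K) ≤ Submodule.comap (ρ g)
          (⨆ (K : Subgroup G) (_ : IsOpen (K : Set G) ∧ IsCompact (K : Set G)), ρ.fixedBy K) from
      fun v hv => h hv
    refine iSup₂_le fun K hK v hv => ?_
    let φ : G ≃ₜ G := (Homeomorph.mulLeft g⁻¹).trans (Homeomorph.mulRight g)
    let L : Subgroup G := K.comap (MulAut.conj g⁻¹).toMonoidHom
    have hL : (L : Set G) = φ ⁻¹' (K : Set G) := by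
      ext x
      simp [L, φ]
    have hL' : IsOpen (L : Set G) ∧ IsCompact (L : Set G) := by
      rw [hL]
      exact ⟨hK.1.preimage φ.continuous, φ.isCompact_preimage.2 hK.2⟩
    refine Submodule.mem_iSup_of_mem L (Submodule.mem_iSup_of_mem hL' fun x hx => ?_)
    have h1 : g⁻¹ * x * g ∈ K := by simpa [L] using hx
    have h2 := congrArg (ρ g) (hv _ h1)
    rw [← Module.End.mul_apply, ← map_mul] at h2
    rw [← Module.End.mul_apply, ← map_mul]
    rwa [show g * (g⁻¹ * x * g) = x * g by group] at h2

/-- The smooth part is the union of the subspaces `V^K`, `K` a compact open subgroup of `G`. -/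
theorem coe_smoothPart {k G V : Type*} [CommRing k] [Group G] [TopologicalSpace G]
    [IsTopologicalGroup G] [AddCommGroup V] [Module k V] (ρ : Representation k G V)
    (hG : ∃ K : Subgroup G, IsOpen (K : Set G) ∧ IsCompact (K : Set G)) :
    (ρ.smoothPart.toSubmodule : Set V) =
      ⋃ (K : Subgroup G) (_ : IsOpen (K : Set G) ∧ IsCompact (K : Set G)),
        {v | ∀ x ∈ K, ρ x v = v} := by
  obtain ⟨K₀, hK₀⟩ := hG
  have : Nonempty {K : Subgroup G // IsOpen (K : Set G) ∧ IsCompact (K : Set G)} := ⟨⟨K₀, hK₀⟩⟩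
  have hdir : Directed (· ≤ ·) fun K : {K : Subgroup G // IsOpen (K : Set G) ∧
      IsCompact (K : Set G)} => ρ.fixedBy K.1 := by
    rintro ⟨K, hK⟩ ⟨L, hL⟩
    refine ⟨⟨K ⊓ L, ?_, ?_⟩, fun v hv x hx => hv x hx.1, fun v hv x hx => hv x hx.2⟩
    · exact hK.1.inter hL.1
    · exact hK.2.inter_right (Subgroup.isClosed_of_isOpen L hL.1)
  ext v
  have : ρ.smoothPart.toSubmodule = ⨆ K : {K : Subgroup G // IsOpen (K : Set G) ∧
      IsCompact (K : Set G)}, ρ.fixedBy K.1 := by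
    rw [iSup_subtype]; rfl
  rw [this, SetLike.mem_coe, Submodule.mem_iSup_of_directed _ hdir]
  simp only [Set.mem_iUnion, Subtype.exists]
  rfl

/-- The morphism `f^sm : V^sm → W^sm` induced by a morphism `f : V → W` of representations. -/
def IntertwiningMap.smoothMap {k G V W : Type*} [CommRing k] [Group G] [TopologicalSpace G]
    [IsTopologicalGroup G] [AddCommGroup V] [Module k V] [AddCommGroup W] [Module k W]
    {ρ : Representation k G V} {σ : Representation k G W} (f : IntertwiningMap ρ σ) :
    IntertwiningMap ρ.smoothPart.toRepresentation σ.smoothPart.toRepresentation where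
  toLinearMap := f.toLinearMap.restrict (p := ρ.smoothPart.toSubmodule)
    (q := σ.smoothPart.toSubmodule) <| by
      suffices h : ρ.smoothPart.toSubmodule ≤
          Submodule.comap f.toLinearMap σ.smoothPart.toSubmodule from fun v hv => h hv
      refine iSup₂_le fun K hK v hv => ?_
      refine Submodule.mem_iSup_of_mem K (Submodule.mem_iSup_of_mem hK fun x hx => ?_)
      change σ x (f v) = f v
      rw [← IntertwiningMap.isIntertwining, hv x hx]
  isIntertwining' := fun g => LinearMap.ext fun v => Subtype.ext (IntertwiningMap.isIntertwining ρ σ f g v)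

end Representation

/-!
Let `f v` be a smooth vector. For `g` in a small compact open subgroup `K` the vector `g v - v`
lies in the kernel of `f`, which is smooth and of exponent `m`. If moreover `g` fixes `g v - v`,
then `g ^ n v - v = n (g v - v)`, so that `g ^ m` fixes `v`. For `x` in `K` some power `y` of `x`
fixes `y v - v`, and the above applies to all elements of the closed subgroup generated by `y`;
their `m`-th powers contain the closed subgroup generated by `y ^ m`, which thus fixes `v`.

In a chart of a `p`-adic analytic group centered at `1`, multiplication is addition up to a
Lipschitz error with a small constant, and taking `n`-th powers is multiplication by `n` up to a
small relative error. By Newton's method, every element close to `1` is a product of elements of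
the closed subgroups generated by fixed powers of the `d` elements on the coordinate axes. All of
these can be taken in the stabilizer of `v`, which is therefore open.
-/

open Metric
open scoped Topology

section Stabilizer

variable {k G V W : Type*} [CommRing k] [Group G] [AddCommGroup V] [Module k V]
  [AddCommGroup W] [Module k W] {ρ : Representation k G V} {σ : Representation k G W}
  {v : V} {g h : G} {m : ℕ}

/-- The stabilizer in `G` of a vector `v` of a representation of `G`. -/
def vectorStabilizer (ρ : Representation k G V) (v : V) : Subgroup G :=
  (MulAction.stabilizer (Module.End k V)ˣ v).comap ρ.asGroupHom

theorem mem_vectorStabilizer : g ∈ vectorStabilizer ρ v ↔ ρ g v = v := Iff.rfl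

theorem apply_pow_sub_self (hg : g ∈ vectorStabilizer ρ (ρ g v - v)) (n : ℕ) :
    ρ (g ^ n) v - v = n • (ρ g v - v) := by
  induction n with
  | zero => simp
  | succ n ih =>
    rw [pow_succ', map_mul, Module.End.mul_apply, sub_eq_iff_eq_add.1 ih, map_add, map_nsmul,
      mem_vectorStabilizer.1 hg, add_smul, one_smul]
    abel

theorem pow_mem_vectorStabilizer (hg : g ∈ vectorStabilizer ρ (ρ g v - v))
    (hm : m • (ρ g v - v) = 0) : g ^ m ∈ vectorStabilizer ρ v := by
  rw [mem_vectorStabilizer, ← sub_eq_zero, apply_pow_sub_self hg, hm]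

theorem mem_vectorStabilizer_apply_sub_of_commute (hgh : Commute g h)
    (hg : g ∈ vectorStabilizer ρ (ρ h v - v)) : h ∈ vectorStabilizer ρ (ρ g v - v) := by
  rw [mem_vectorStabilizer, map_sub, ← Module.End.mul_apply, ← map_mul] at hg ⊢
  rw [← hgh.eq, sub_eq_iff_eq_add.1 hg]
  abel

theorem map_apply_sub_eq_zero (f : Representation.IntertwiningMap ρ σ)
    (hg : g ∈ vectorStabilizer σ (f v)) : f (ρ g v - v) = 0 := by
  rw [map_sub, Representation.IntertwiningMap.isIntertwining, mem_vectorStabilizer.1 hg, sub_self]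

variable [TopologicalSpace G]

theorem isOpen_vectorStabilizer_of_isSmooth (hρ : ρ.IsSmooth) (v : V) :
    IsOpen (vectorStabilizer ρ v : Set G) := by
  let _ : TopologicalSpace V := ⊥
  have : DiscreteTopology V := ⟨rfl⟩
  have orbit_continuous : Continuous fun g : G ↦ ρ g v :=
    Continuous.comp (g := fun x : G × V ↦ ρ x.1 x.2) hρ (Continuous.prodMk_left v)
  exact (isOpen_discrete {v}).preimage orbit_continuous

theorem isOpen_vectorStabilizer_of_mem {U : Subrepresentation ρ}
    (hU : U.toRepresentation.IsSmooth) {u : V} (hu : u ∈ U.toSubmodule) :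
    IsOpen (vectorStabilizer ρ u : Set G) := by
  convert isOpen_vectorStabilizer_of_isSmooth hU ⟨u, hu⟩ using 2
  ext x
  rw [mem_vectorStabilizer, mem_vectorStabilizer, Subtype.ext_iff]
  rfl

theorem mem_smoothPart_iff_isOpen_vectorStabilizer [IsTopologicalGroup G]
    (hG : ∃ K : Subgroup G, IsOpen (K : Set G) ∧ IsCompact (K : Set G)) :
    v ∈ ρ.smoothPart.toSubmodule ↔ IsOpen (vectorStabilizer ρ v : Set G) := by
  rw [← SetLike.mem_coe, ρ.coe_smoothPart hG]
  simp only [Set.mem_iUnion]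
  constructor
  · rintro ⟨K, ⟨hKo, -⟩, hKv⟩
    exact Subgroup.isOpen_mono (fun x hx ↦ hKv x hx) hKo
  · intro hv
    obtain ⟨K, hKo, hKc⟩ := hG
    exact ⟨K ⊓ vectorStabilizer ρ v, ⟨hKo.inter hv,
      hKc.inter_right (Subgroup.isClosed_of_isOpen _ hv)⟩, fun x hx ↦ hx.2⟩

end Stabilizer

section ProcyclicSubgroup

variable {G : Type*} [Group G] [TopologicalSpace G] [IsTopologicalGroup G]

theorem exists_pow_mem_of_isOpen_of_isCompact {K S : Subgroup G} (hK : IsCompact (K : Set G))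
    (hS : IsOpen (S : Set G)) {x : G} (hx : x ∈ K) : ∃ n : ℕ, 0 < n ∧ x ^ n ∈ S := by
  have : CompactSpace K := isCompact_iff_compactSpace.1 hK
  have : Finite (K ⧸ S.subgroupOf K) :=
    Subgroup.quotient_finite_of_isOpen _ (hS.preimage continuous_subtype_val)
  have : (S.subgroupOf K).FiniteIndex := Subgroup.finiteIndex_of_finite_quotient
  obtain ⟨n, hn, -, hxn⟩ := Subgroup.exists_pow_mem_of_index_ne_zero
    (H := S.subgroupOf K) Subgroup.FiniteIndex.index_ne_zero ⟨x, hx⟩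
  exact ⟨n, hn, hxn⟩

theorem topologicalClosure_zpowers_le {x : G} {S : Subgroup G} (hx : x ∈ S)
    (hS : IsClosed (S : Set G)) : (Subgroup.zpowers x).topologicalClosure ≤ S :=
  Subgroup.topologicalClosure_minimal _ (Subgroup.zpowers_le.2 hx) hS

theorem mem_topologicalClosure_zpowers (x : G) :
    x ∈ (Subgroup.zpowers x).topologicalClosure :=
  Subgroup.le_topologicalClosure _ (Subgroup.mem_zpowers x)

variable [T2Space G]

theorem commute_of_mem_topologicalClosure_zpowers {x t : G}
    (ht : t ∈ (Subgroup.zpowers x).topologicalClosure) : Commute x t :=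
  Subgroup.mem_centralizer_iff.1 (topologicalClosure_zpowers_le
    (Subgroup.mem_centralizer_singleton_iff.2 rfl) (Set.isClosed_centralizer {x}) ht) x rfl

theorem topologicalClosure_zpowers_pow_subset {x : G} (m : ℕ)
    (hx : IsCompact ((Subgroup.zpowers x).topologicalClosure : Set G)) :
    ((Subgroup.zpowers (x ^ m)).topologicalClosure : Set G) ⊆
      (· ^ m) '' ((Subgroup.zpowers x).topologicalClosure : Set G) := by
  refine closure_minimal ?_ (hx.image (continuous_pow m)).isClosed
  rintro _ ⟨j, rfl⟩
  exact ⟨x ^ j, Subgroup.le_topologicalClosure _ ⟨j, rfl⟩,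
    by simpa only [zpow_natCast] using zpow_comm x j m⟩

variable {k V : Type*} [CommRing k] [AddCommGroup V] [Module k V]
  {ρ : Representation k G V} {v : V} {m : ℕ}

theorem pow_mem_vectorStabilizer_of_mem_topologicalClosure {y t : G}
    (hy : y ∈ vectorStabilizer ρ (ρ y v - v))
    (hclosed : ∀ s ∈ (Subgroup.zpowers y).topologicalClosure,
      IsClosed (vectorStabilizer ρ (ρ s v - v) : Set G))
    (ht : t ∈ (Subgroup.zpowers y).topologicalClosure) (hm : m • (ρ t v - v) = 0) :
    t ^ m ∈ vectorStabilizer ρ v := by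
  have ht_fixes : t ∈ vectorStabilizer ρ (ρ y v - v) :=
    topologicalClosure_zpowers_le hy (hclosed y (mem_topologicalClosure_zpowers y)) ht
  have hy_fixes : y ∈ vectorStabilizer ρ (ρ t v - v) :=
    mem_vectorStabilizer_apply_sub_of_commute
      (commute_of_mem_topologicalClosure_zpowers ht).symm ht_fixes
  exact pow_mem_vectorStabilizer (topologicalClosure_zpowers_le hy_fixes (hclosed t ht) ht) hm

theorem exists_topologicalClosure_zpowers_pow_le_vectorStabilizer (hm : 0 < m) {K : Subgroup G}
    (hK : IsCompact (K : Set G))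
    (hopen : ∀ g ∈ K, IsOpen (vectorStabilizer ρ (ρ g v - v) : Set G))
    (htors : ∀ g ∈ K, m • (ρ g v - v) = 0) {x : G} (hx : x ∈ K) :
    ∃ N : ℕ, 0 < N ∧ (Subgroup.zpowers (x ^ N)).topologicalClosure ≤ vectorStabilizer ρ v := by
  obtain ⟨n, hn, hxn⟩ := exists_pow_mem_of_isOpen_of_isCompact hK (hopen x hx) hx
  have hle : (Subgroup.zpowers (x ^ n)).topologicalClosure ≤ K :=
    topologicalClosure_zpowers_le (K.pow_mem hx n) hK.isClosed
  have hfix : x ^ n ∈ vectorStabilizer ρ (ρ (x ^ n) v - v) :=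
    Subgroup.pow_mem _ (mem_vectorStabilizer_apply_sub_of_commute
      (Commute.pow_self x n) hxn) n
  refine ⟨n * m, Nat.mul_pos hn hm, fun g hg ↦ ?_⟩
  rw [pow_mul] at hg
  obtain ⟨t, ht, rfl⟩ := topologicalClosure_zpowers_pow_subset m
    (hK.of_isClosed_subset isClosed_closure hle) hg
  exact pow_mem_vectorStabilizer_of_mem_topologicalClosure hfix
    (fun s hs ↦ Subgroup.isClosed_of_isOpen _ (hopen s (hle hs))) ht (htors t (hle ht))

end ProcyclicSubgroup

section Ultrametric

variable {E : Type*} [SeminormedAddCommGroup E] [IsUltrametricDist E] {x y z : E} {M : ℝ}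

theorem norm_sub_le_of_norm_sub_le (hxy : ‖x - y‖ ≤ M) (hyz : ‖y - z‖ ≤ M) : ‖x - z‖ ≤ M := by
  rw [← dist_eq_norm] at *
  exact (dist_triangle_max x y z).trans (max_le hxy hyz)

theorem norm_le_of_norm_sub_le (hxy : ‖x - y‖ ≤ M) (hy : ‖y‖ ≤ M) : ‖x‖ ≤ M := by
  simpa using norm_sub_le_of_norm_sub_le (z := 0) hxy (by simpa using hy)

end Ultrametric

theorem inv_le_norm_prime_cast {p : ℕ} [Fact p.Prime] {q : ℕ} (hq : q.Prime) :
    (p : ℝ)⁻¹ ≤ ‖(q : ℚ_[p])‖ := by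
  rcases eq_or_ne q p with rfl | hqp
  · exact Padic.norm_p.ge
  · rw [Padic.norm_natCast_eq_one_iff.2 ((Nat.coprime_primes Fact.out hq).2 hqp.symm)]
    exact Nat.cast_inv_le_one p

theorem exists_natCast_mul_sub_norm_le {p : ℕ} [Fact p.Prime] {N : ℕ} {a : ℚ_[p]}
    (ha : ‖a‖ ≤ ‖(N : ℚ_[p])‖) :
    ∃ l : ℕ, ‖((N * l : ℕ) : ℚ_[p]) - a‖ ≤ (p : ℝ)⁻¹ * ‖a‖ := by
  rcases eq_or_ne a 0 with rfl | ha₀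
  · exact ⟨0, by simp⟩
  have hN : (N : ℚ_[p]) ≠ 0 := norm_pos_iff.1 ((norm_pos_iff.2 ha₀).trans_le ha)
  let z : ℤ_[p] := ⟨a / N, by rw [norm_div]; exact div_le_one_of_le₀ ha (norm_nonneg _)⟩
  have hp : 0 < (p : ℝ) := Nat.cast_pos.2 (Fact.out : p.Prime).pos
  obtain ⟨l, hl⟩ := PadicInt.denseRange_natCast.exists_dist_lt z
    (ε := (p : ℝ)⁻¹ * ‖a‖ / ‖(N : ℚ_[p])‖) (by positivity)
  refine ⟨l, ?_⟩
  rw [dist_comm, dist_eq_norm, lt_div_iff₀ (norm_pos_iff.2 hN), PadicInt.norm_def] at hl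
  have : ((N * l : ℕ) : ℚ_[p]) - a = (((l : ℤ_[p]) - z : ℤ_[p]) : ℚ_[p]) * N := by
    rw [PadicInt.coe_sub, PadicInt.coe_natCast, Nat.cast_mul, sub_mul, mul_comm,
      show (z : ℚ_[p]) * N = a from div_mul_cancel₀ a hN]
  rw [this, norm_mul]
  exact hl.le

section OrderedProd

variable {ι G : Type*} [Fintype ι]

/-- The product of a finite family in a noncommutative monoid, in the fixed but arbitrary order
of `Finset.univ.toList`. -/
noncomputable def orderedProd [Monoid G] (c : ι → G) : G :=
  (Finset.univ.toList.map c).prod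

theorem orderedProd_one [Monoid G] : orderedProd (1 : ι → G) = 1 :=
  List.prod_map_one

theorem orderedProd_mem [Group G] {S : Subgroup G} {c : ι → G} (hc : ∀ i, c i ∈ S) :
    orderedProd c ∈ S :=
  S.list_prod_mem <| List.forall_mem_map.2 fun i _ ↦ hc i

theorem continuous_orderedProd [Monoid G] [TopologicalSpace G] [ContinuousMul G] :
    Continuous (orderedProd : (ι → G) → G) :=
  continuous_list_prod _ fun i _ ↦ continuous_apply i

end OrderedProd

/-- The map `ψ` from a group to a normed group sends `1` to `0` and, on `s`, turns products into
sums up to an error `ψ (x * y) - (ψ x + ψ y)` that is `ε`-Lipschitz in `(ψ x, ψ y)`. A chart of a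
Lie group centered at `1` has this property on a small neighbourhood of `1`. -/
structure NearlyAdditive {G E : Type*} [Group G] [NormedAddCommGroup E] (ψ : G → E)
    (s : Set G) (ε : ℝ) : Prop where
  one_mem : 1 ∈ s
  map_one : ψ 1 = 0
  norm_sub_le : ∀ x ∈ s, ∀ y ∈ s, ∀ x' ∈ s, ∀ y' ∈ s,
    ‖ψ (x * y) - ψ (x' * y') - ((ψ x - ψ x') + (ψ y - ψ y'))‖ ≤
      ε * max ‖ψ x - ψ x'‖ ‖ψ y - ψ y'‖

namespace NearlyAdditive

section NormedGroup

variable {G E : Type*} [Group G] [NormedAddCommGroup E] {ψ : G → E} {s : Set G}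
  {K : Subgroup G} {ε M : ℝ} {x y : G}

theorem mono (hψ : NearlyAdditive ψ s ε) {ε' : ℝ} (hε : ε ≤ ε') : NearlyAdditive ψ s ε' where
  one_mem := hψ.one_mem
  map_one := hψ.map_one
  norm_sub_le x hx y hy x' hx' y' hy' :=
    (hψ.norm_sub_le x hx y hy x' hx' y' hy').trans (by gcongr)

theorem norm_mul_sub_le_left (hψ : NearlyAdditive ψ s ε) (hx : x ∈ s) (hy : y ∈ s) :
    ‖ψ (x * y) - (ψ x + ψ y)‖ ≤ ε * ‖ψ x‖ := by
  have := hψ.norm_sub_le x hx y hy 1 hψ.one_mem y hy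
  simpa [hψ.map_one, sub_sub, add_comm] using this

theorem norm_mul_sub_le_right (hψ : NearlyAdditive ψ s ε) (hx : x ∈ s) (hy : y ∈ s) :
    ‖ψ (x * y) - (ψ x + ψ y)‖ ≤ ε * ‖ψ y‖ := by
  have := hψ.norm_sub_le x hx y hy x hx 1 hψ.one_mem
  simpa [hψ.map_one, sub_sub] using this

variable [IsUltrametricDist E]

theorem norm_mul_le (hψ : NearlyAdditive ψ s ε) (hε : ε ≤ 1) (hx : x ∈ s) (hy : y ∈ s)
    (hxM : ‖ψ x‖ ≤ M) (hyM : ‖ψ y‖ ≤ M) : ‖ψ (x * y)‖ ≤ M :=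
  norm_le_of_norm_sub_le
    ((hψ.norm_mul_sub_le_left hx hy).trans
      ((mul_le_of_le_one_left (norm_nonneg _) hε).trans hxM))
    ((IsUltrametricDist.norm_add_le_max _ _).trans (max_le hxM hyM))

theorem norm_inv_le (hψ : NearlyAdditive ψ s ε) (hε : ε ≤ 1) (hx : x ∈ s) (hx' : x⁻¹ ∈ s) :
    ‖ψ x⁻¹‖ ≤ ‖ψ x‖ := by
  have h := hψ.norm_mul_sub_le_left hx hx'
  rw [mul_inv_cancel, hψ.map_one, zero_sub, norm_neg] at h
  refine norm_le_of_norm_sub_le (y := -ψ x) ?_ (norm_neg _).le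
  rw [sub_neg_eq_add, add_comm]
  exact h.trans (mul_le_of_le_one_left (norm_nonneg _) hε)

theorem norm_mul_sub_sub_le (hψ : NearlyAdditive ψ s ε) (hε₀ : 0 ≤ ε) (hε : ε ≤ 1) {w : E}
    (hx : x ∈ s) (hy : y ∈ s) (hyw : ‖ψ y - w‖ ≤ ε * M) (hw : ‖w‖ ≤ M) :
    ‖ψ (x * y) - ψ x - w‖ ≤ ε * M := by
  have hM : 0 ≤ M := (norm_nonneg w).trans hw
  have hyM : ‖ψ y‖ ≤ M := norm_le_of_norm_sub_le (hyw.trans (mul_le_of_le_one_left hM hε)) hw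
  refine norm_sub_le_of_norm_sub_le (y := ψ y) ?_ hyw
  rw [sub_sub]
  exact (hψ.norm_mul_sub_le_right hx hy).trans (mul_le_mul_of_nonneg_left hyM hε₀)

theorem norm_list_prod_sub_le (hψ : NearlyAdditive ψ K ε) (hε₀ : 0 ≤ ε) (hε : ε ≤ 1)
    {ι : Type*} {c c' : ι → G} (hc : ∀ i, c i ∈ K) (hc' : ∀ i, c' i ∈ K) (hM : 0 ≤ M)
    (hcc' : ∀ i, ‖ψ (c i) - ψ (c' i)‖ ≤ M) (l : List ι) :
    ‖ψ (l.map c).prod - ψ (l.map c').prod - (l.map fun i ↦ ψ (c i) - ψ (c' i)).sum‖ ≤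
      ε * M := by
  induction l with
  | nil => simpa using mul_nonneg hε₀ hM
  | cons i l ih =>
    simp only [List.map_cons, List.prod_cons, List.sum_cons]
    have hP : (l.map c).prod ∈ K := K.list_prod_mem <| List.forall_mem_map.2 fun j _ ↦ hc j
    have hP' : (l.map c').prod ∈ K := K.list_prod_mem <| List.forall_mem_map.2 fun j _ ↦ hc' j
    have hsum : ‖(l.map fun j ↦ ψ (c j) - ψ (c' j)).sum‖ ≤ M :=
      List.sum_induction (‖·‖ ≤ M)
        (fun a b ha hb ↦ (IsUltrametricDist.norm_add_le_max a b).trans (max_le ha hb))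
        (by simpa using hM) (List.forall_mem_map.2 fun j _ ↦ hcc' j)
    have htail : ‖ψ (l.map c).prod - ψ (l.map c').prod‖ ≤ M :=
      norm_le_of_norm_sub_le (ih.trans (mul_le_of_le_one_left hM hε)) hsum
    refine norm_sub_le_of_norm_sub_le ((hψ.norm_sub_le _ (hc i) _ hP _ (hc' i) _ hP').trans
      (mul_le_mul_of_nonneg_left (max_le (hcc' i) htail) hε₀)) ?_
    rwa [add_sub_add_left_eq_sub]

theorem norm_pow_sub_le (hψ : NearlyAdditive ψ K ε) (hε₀ : 0 ≤ ε) (hε : ε ≤ 1) (hx : x ∈ K)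
    (n : ℕ) : ‖ψ (x ^ n) - n • ψ x‖ ≤ ε * ‖ψ x‖ := by
  have := hψ.norm_list_prod_sub_le hε₀ hε (c := fun _ ↦ x) (c' := fun _ ↦ 1) (fun _ ↦ hx)
    (fun _ ↦ K.one_mem) (norm_nonneg (ψ x)) (by simp [hψ.map_one]) (List.range n)
  simpa [hψ.map_one] using this

theorem norm_orderedProd_sub_le (hψ : NearlyAdditive ψ K ε) (hε₀ : 0 ≤ ε) (hε : ε ≤ 1)
    {ι : Type*} [Fintype ι] {c c' : ι → G} (hc : ∀ i, c i ∈ K) (hc' : ∀ i, c' i ∈ K)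
    (hM : 0 ≤ M) (hcc' : ∀ i, ‖ψ (c i) - ψ (c' i)‖ ≤ M) :
    ‖ψ (orderedProd c) - ψ (orderedProd c') - ∑ i, (ψ (c i) - ψ (c' i))‖ ≤ ε * M := by
  rw [← Finset.sum_map_toList]
  exact hψ.norm_list_prod_sub_le hε₀ hε hc hc' hM hcc' _

end NormedGroup

section OrderedProd

variable {G ι F : Type*} [Group G] [Fintype ι] [DecidableEq ι] [NormedAddCommGroup F]
  [IsUltrametricDist F] {ψ : G → ι → F} {K : Subgroup G} {C : ι → Subgroup G} {ε R : ℝ}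

/-- A step of Newton's method: correct every factor `c i` by an element of `C i` that
approximates the `i`-th coordinate of the error. -/
theorem exists_norm_orderedProd_sub_le (hψ : NearlyAdditive ψ K ε) (hε₀ : 0 ≤ ε) (hε : ε ≤ 1)
    (hCK : ∀ i, C i ≤ K)
    (hC : ∀ i, ∀ a : F, ‖a‖ ≤ R → ∃ v ∈ C i, ‖ψ v - Pi.single i a‖ ≤ ε * ‖a‖) {y : ι → F}
    {c : ι → G} (hc : ∀ i, c i ∈ C i) (hy : ‖ψ (orderedProd c) - y‖ ≤ R) :
    ∃ c' : ι → G, (∀ i, c' i ∈ C i) ∧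
      ‖ψ (orderedProd c') - y‖ ≤ ε * ‖ψ (orderedProd c) - y‖ := by
  rw [norm_sub_rev] at hy ⊢
  set δ := y - ψ (orderedProd c) with hδ
  have hδi (i : ι) : ‖δ i‖ ≤ ‖δ‖ := norm_le_pi_norm δ i
  have hsingle (i : ι) : ‖(Pi.single i (δ i) : ι → F)‖ ≤ ‖δ‖ := (Pi.norm_single _).trans_le (hδi i)
  choose v hvC hv using fun i ↦ hC i (δ i) ((hδi i).trans hy)
  have factor_error (i : ι) : ‖ψ (c i * v i) - ψ (c i) - Pi.single i (δ i)‖ ≤ ε * ‖δ‖ :=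
    hψ.norm_mul_sub_sub_le hε₀ hε (hCK i (hc i)) (hCK i (hvC i))
      ((hv i).trans (mul_le_mul_of_nonneg_left (hδi i) hε₀)) (hsingle i)
  have factor_change (i : ι) : ‖ψ (c i * v i) - ψ (c i)‖ ≤ ‖δ‖ :=
    norm_le_of_norm_sub_le
      ((factor_error i).trans (mul_le_of_le_one_left (norm_nonneg _) hε)) (hsingle i)
  have sum_error : ‖∑ i, (ψ (c i * v i) - ψ (c i)) - δ‖ ≤ ε * ‖δ‖ := by
    have : ∑ i, (ψ (c i * v i) - ψ (c i)) - δ =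
        ∑ i, (ψ (c i * v i) - ψ (c i) - Pi.single i (δ i)) := by
      rw [Finset.sum_sub_distrib _ fun i ↦ Pi.single i (δ i), Finset.univ_sum_single]
    rw [this]
    exact IsUltrametricDist.norm_sum_le_of_forall_le_of_nonneg (by positivity)
      fun i _ ↦ factor_error i
  have prod_error : ‖ψ (orderedProd fun i ↦ c i * v i) - ψ (orderedProd c) -
      ∑ i, (ψ (c i * v i) - ψ (c i))‖ ≤ ε * ‖δ‖ :=
    hψ.norm_orderedProd_sub_le hε₀ hε (fun i ↦ K.mul_mem (hCK i (hc i)) (hCK i (hvC i)))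
      (fun i ↦ hCK i (hc i)) (norm_nonneg δ) factor_change
  refine ⟨fun i ↦ c i * v i, fun i ↦ (C i).mul_mem (hc i) (hvC i), ?_⟩
  simpa [hδ] using norm_sub_le_of_norm_sub_le prod_error sum_error

/-- The error is minimal at some family in the compact set `∏ i, C i`, and a Newton step would
decrease it further unless it vanishes. -/
theorem exists_map_orderedProd_eq [TopologicalSpace G] [IsTopologicalGroup G]
    (hψ : NearlyAdditive ψ K ε) (hε₀ : 0 ≤ ε) (hε : ε < 1) (hcont : ContinuousOn ψ K)
    (hCK : ∀ i, C i ≤ K) (hCc : ∀ i, IsCompact (C i : Set G))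
    (hC : ∀ i, ∀ a : F, ‖a‖ ≤ R → ∃ v ∈ C i, ‖ψ v - Pi.single i a‖ ≤ ε * ‖a‖) {y : ι → F}
    (hy : ‖y‖ ≤ R) : ∃ c : ι → G, (∀ i, c i ∈ C i) ∧ ψ (orderedProd c) = y := by
  have one_mem_pi : (1 : ι → G) ∈ Set.univ.pi fun i ↦ (C i : Set G) := fun i _ ↦ (C i).one_mem
  have mapsTo_orderedProd : Set.MapsTo orderedProd (Set.univ.pi fun i ↦ (C i : Set G)) K :=
    fun c hc ↦ orderedProd_mem fun i ↦ hCK i (hc i trivial)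
  have error_continuousOn : ContinuousOn (fun c : ι → G ↦ ‖ψ (orderedProd c) - y‖)
      (Set.univ.pi fun i ↦ (C i : Set G)) :=
    ((hcont.comp continuous_orderedProd.continuousOn mapsTo_orderedProd).sub
      continuousOn_const).norm
  obtain ⟨c, hc, hmin⟩ :=
    (isCompact_univ_pi hCc).exists_isMinOn ⟨1, one_mem_pi⟩ error_continuousOn
  have hcR : ‖ψ (orderedProd c) - y‖ ≤ R := by
    refine (hmin one_mem_pi).trans ?_
    simpa [orderedProd_one, hψ.map_one] using hy
  obtain ⟨c', hc', hle⟩ := hψ.exists_norm_orderedProd_sub_le hε₀ hε.le hCK hC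
    (fun i ↦ hc i trivial) hcR
  have error_le : ‖ψ (orderedProd c) - y‖ ≤ ε * ‖ψ (orderedProd c) - y‖ :=
    (hmin fun i _ ↦ hc' i).trans hle
  refine ⟨c, fun i ↦ hc i trivial, sub_eq_zero.1 (norm_le_zero_iff.1 ?_)⟩
  nlinarith

end OrderedProd

section Padic

variable {p : ℕ} [Fact p.Prime] {G E : Type*} [Group G] [NormedAddCommGroup E]
  [NormedSpace ℚ_[p] E] [IsUltrametricDist E] {ψ : G → E} {K : Subgroup G} {x : G}

/-- For `n` prime, the error is at most `p⁻¹ ^ 2 * ‖ψ x‖`, and `p⁻¹ ≤ ‖n‖`; the general case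
follows by writing `n` as a product of primes. -/
theorem norm_pow_sub_smul_le (hψ : NearlyAdditive ψ K ((p : ℝ)⁻¹ ^ 2)) (hx : x ∈ K) (n : ℕ) :
    ‖ψ (x ^ n) - (n : ℚ_[p]) • ψ x‖ ≤ (p : ℝ)⁻¹ * (‖(n : ℚ_[p])‖ * ‖ψ x‖) := by
  induction n using induction_on_primes generalizing x with
  | zero => simp [hψ.map_one]
  | one => simpa using by positivity
  | prime_mul q n hq ih =>
    have hp₁ : (p : ℝ)⁻¹ ≤ 1 := Nat.cast_inv_le_one p
    have prime_error : ‖ψ (x ^ q) - (q : ℚ_[p]) • ψ x‖ ≤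
        (p : ℝ)⁻¹ * (‖(q : ℚ_[p])‖ * ‖ψ x‖) := by
      rw [Nat.cast_smul_eq_nsmul, ← mul_assoc]
      refine (hψ.norm_pow_sub_le (by positivity) (pow_le_one₀ (by positivity) hp₁) hx q).trans ?_
      rw [sq]
      gcongr
      exact inv_le_norm_prime_cast hq
    have norm_prime_pow : ‖ψ (x ^ q)‖ ≤ ‖(q : ℚ_[p])‖ * ‖ψ x‖ :=
      norm_le_of_norm_sub_le (prime_error.trans (mul_le_of_le_one_left (by positivity) hp₁))
        (norm_smul_le _ _)
    rw [pow_mul, Nat.cast_mul, norm_mul]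
    refine norm_sub_le_of_norm_sub_le (y := (n : ℚ_[p]) • ψ (x ^ q)) ?_ ?_
    · refine (ih (K.pow_mem hx q)).trans ?_
      rw [mul_comm ‖(q : ℚ_[p])‖, mul_assoc]
      gcongr
    · rw [mul_comm (q : ℚ_[p]), mul_smul, ← smul_sub, norm_smul]
      refine (mul_le_mul_of_nonneg_left prime_error (norm_nonneg _)).trans_eq ?_
      ring

theorem exists_pow_norm_sub_smul_le (hψ : NearlyAdditive ψ K ((p : ℝ)⁻¹ ^ 2)) (hx : x ∈ K)
    {N : ℕ} {a : ℚ_[p]} (ha : ‖a‖ ≤ ‖(N : ℚ_[p])‖) :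
    ∃ l : ℕ, ‖ψ ((x ^ N) ^ l) - a • ψ x‖ ≤ (p : ℝ)⁻¹ * (‖a‖ * ‖ψ x‖) := by
  obtain ⟨l, hl⟩ := exists_natCast_mul_sub_norm_le ha
  have hNl : ‖((N * l : ℕ) : ℚ_[p])‖ ≤ ‖a‖ := norm_le_of_norm_sub_le
    (hl.trans (mul_le_of_le_one_left (norm_nonneg a) (Nat.cast_inv_le_one p))) le_rfl
  refine ⟨l, ?_⟩
  rw [← pow_mul]
  refine norm_sub_le_of_norm_sub_le (y := ((N * l : ℕ) : ℚ_[p]) • ψ x) ?_ ?_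
  · refine (hψ.norm_pow_sub_smul_le hx _).trans ?_
    gcongr
  · rw [← sub_smul, ← mul_assoc]
    exact (norm_smul_le _ _).trans (mul_le_mul_of_nonneg_right hl (norm_nonneg _))

theorem exists_mem_zpowers_norm_sub_single_le {ι : Type*} [Fintype ι] [DecidableEq ι]
    {ψ : G → ι → ℚ_[p]} (hψ : NearlyAdditive ψ K ((p : ℝ)⁻¹ ^ 2)) (hx : x ∈ K) {i : ι}
    {b : ℚ_[p]} (hb : b ≠ 0) (hxb : ψ x = Pi.single i b) {N : ℕ} {a : ℚ_[p]}
    (ha : ‖a‖ ≤ ‖(N : ℚ_[p])‖ * ‖b‖) :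
    ∃ v ∈ Subgroup.zpowers (x ^ N), ‖ψ v - Pi.single i a‖ ≤ (p : ℝ)⁻¹ * ‖a‖ := by
  have hab : ‖a / b‖ ≤ ‖(N : ℚ_[p])‖ := by
    rwa [norm_div, div_le_iff₀ (norm_pos_iff.2 hb)]
  obtain ⟨l, hl⟩ := hψ.exists_pow_norm_sub_smul_le hx hab
  rw [hxb, Pi.norm_single, ← norm_mul, ← Pi.single_smul, smul_eq_mul, div_mul_cancel₀ a hb] at hl
  exact ⟨(x ^ N) ^ l, Subgroup.npow_mem_zpowers _ l, hl⟩

end Padic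

end NearlyAdditive

section CenteredChart

variable {𝕜 E G : Type*} [NontriviallyNormedField 𝕜] [NormedAddCommGroup E] [NormedSpace 𝕜 E]

theorem eq_fst_add_snd_of_hasFDerivAt {F : E × E → E} {L : E × E →L[𝕜] E}
    (hF : HasFDerivAt F L 0) (hleft : ∀ᶠ x in 𝓝 0, F (x, 0) = x)
    (hright : ∀ᶠ x in 𝓝 0, F (0, x) = x) :
    L = ContinuousLinearMap.fst 𝕜 E E + ContinuousLinearMap.snd 𝕜 E E := by
  have hinl : L.comp (ContinuousLinearMap.inl 𝕜 E E) = ContinuousLinearMap.id 𝕜 E :=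
    (hF.comp (f := fun x ↦ (x, 0)) 0 (hasFDerivAt_prodMk_left 0 0)).unique
      ((hasFDerivAt_id 0).congr_of_eventuallyEq hleft)
  have hinr : L.comp (ContinuousLinearMap.inr 𝕜 E E) = ContinuousLinearMap.id 𝕜 E :=
    (hF.comp (f := fun x ↦ (0, x)) 0 (hasFDerivAt_prodMk_right 0 0)).unique
      ((hasFDerivAt_id 0).congr_of_eventuallyEq hright)
  ext x
  · simpa using DFunLike.congr_fun hinl x
  · simpa using DFunLike.congr_fun hinr x

variable [Group G] [TopologicalSpace G]

theorem hasStrictFDerivAt_mul_of_mem_maximalAtlas [ChartedSpace E G]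
    [LieGroup 𝓘(𝕜, E) ω G] {ψ : OpenPartialHomeomorph G E}
    (hψ : ψ ∈ IsManifold.maximalAtlas 𝓘(𝕜, E) ω G) (hsource : 1 ∈ ψ.source) (hψ₁ : ψ 1 = 0) :
    HasStrictFDerivAt (fun z : E × E ↦ ψ (ψ.symm z.1 * ψ.symm z.2))
      (ContinuousLinearMap.fst 𝕜 E E + ContinuousLinearMap.snd 𝕜 E E) 0 := by
  have htarget : 0 ∈ ψ.target := hψ₁ ▸ ψ.map_source hsource
  have hsymm₀ : ψ.symm 0 = 1 := hψ₁ ▸ ψ.left_inv hsource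
  have smooth_symm : ContMDiffAt 𝓘(𝕜, E) 𝓘(𝕜, E) ω ψ.symm 0 :=
    contMDiffAt_symm_of_mem_maximalAtlas hψ htarget
  have smooth_fst : ContMDiffAt 𝓘(𝕜, E × E) 𝓘(𝕜, E) ω (fun z : E × E ↦ ψ.symm z.1) 0 :=
    ContMDiffAt.comp (0 : E × E) smooth_symm contDiff_fst.contMDiff.contMDiffAt
  have smooth_snd : ContMDiffAt 𝓘(𝕜, E × E) 𝓘(𝕜, E) ω (fun z : E × E ↦ ψ.symm z.2) 0 :=
    ContMDiffAt.comp (0 : E × E) smooth_symm contDiff_snd.contMDiff.contMDiffAt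
  have smooth_mul : ContMDiffAt 𝓘(𝕜, E × E) 𝓘(𝕜, E) ω
      (fun z : E × E ↦ ψ (ψ.symm z.1 * ψ.symm z.2)) 0 :=
    (contMDiffAt_of_mem_maximalAtlas hψ hsource).comp_of_eq (smooth_fst.mul smooth_snd)
      (by simp [hsymm₀])
  have hF := smooth_mul.contDiffAt.analyticAt.hasStrictFDerivAt
  have right_inv : ∀ᶠ x in 𝓝 0, ψ (ψ.symm x) = x := ψ.eventually_right_inverse htarget
  rwa [eq_fst_add_snd_of_hasFDerivAt hF.hasFDerivAt (by simpa [hsymm₀] using right_inv)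
    (by simpa [hsymm₀] using right_inv)] at hF

theorem exists_mem_maximalAtlas_map_eq_zero {M : Type*} [TopologicalSpace M] [ChartedSpace E M]
    {n : WithTop ℕ∞} [IsManifold 𝓘(𝕜, E) n M] (x : M) :
    ∃ ψ ∈ IsManifold.maximalAtlas 𝓘(𝕜, E) n M, x ∈ ψ.source ∧ ψ x = 0 := by
  let e := chartAt E x
  have he : e ∈ IsManifold.maximalAtlas 𝓘(𝕜, E) n M := IsManifold.chart_mem_maximalAtlas x
  let τ := Homeomorph.addRight (-e x)
  have translation_smooth (a : E) : ContMDiff 𝓘(𝕜, E) 𝓘(𝕜, E) n fun y ↦ y + a :=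
    (contDiff_id.add contDiff_const).contMDiff
  refine ⟨e.transHomeomorph τ, ?_, mem_chart_source E x, by simp [τ, e]⟩
  refine OpenPartialHomeomorph.mem_maximalAtlas_of_contMDiffOn _ ?_ ?_
  · exact (translation_smooth (-e x)).comp_contMDiffOn (contMDiffOn_of_mem_maximalAtlas he)
  · exact (contMDiffOn_symm_of_mem_maximalAtlas he).comp
      (translation_smooth _).contMDiffOn fun y hy ↦ hy

end CenteredChart

section ChartBall

variable {G E : Type*} [NormedAddCommGroup E] [TopologicalSpace G]

/-- The closed ball of radius `r` around the origin of the chart `ψ`, as a subset of the source.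
Radii for which the ball in `E` is not contained in the target of `ψ` are allowed. -/
def chartBall (ψ : OpenPartialHomeomorph G E) (r : ℝ) : Set G :=
  ψ.source ∩ ψ ⁻¹' closedBall 0 r

variable {ψ : OpenPartialHomeomorph G E} {r : ℝ} {g : G}

theorem mem_chartBall : g ∈ chartBall ψ r ↔ g ∈ ψ.source ∧ ‖ψ g‖ ≤ r := by
  rw [← mem_closedBall_zero_iff]
  rfl

theorem symm_mem_chartBall {y : E} (hr : closedBall 0 r ⊆ ψ.target) (hy : ‖y‖ ≤ r) :
    ψ.symm y ∈ chartBall ψ r := by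
  have hyt := hr (mem_closedBall_zero_iff.2 hy)
  exact mem_chartBall.2 ⟨ψ.map_target hyt, by rwa [ψ.right_inv hyt]⟩

theorem isCompact_chartBall [ProperSpace E] (hr : closedBall 0 r ⊆ ψ.target) :
    IsCompact (chartBall ψ r) := by
  rw [chartBall, ← ψ.symm_image_eq_source_inter_preimage hr]
  exact (isCompact_closedBall 0 r).image_of_continuousOn (ψ.continuousOn_symm.mono hr)

variable [Group G]

theorem chartBall_mem_nhds_one (hsource : 1 ∈ ψ.source) (hψ₁ : ψ 1 = 0) (hr : 0 < r) :
    chartBall ψ r ∈ 𝓝 1 :=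
  Filter.inter_mem (ψ.open_source.mem_nhds hsource)
    ((ψ.continuousAt hsource).preimage_mem_nhds (by rw [hψ₁]; exact closedBall_mem_nhds 0 hr))

theorem eventually_chartBall_subset (hsource : 1 ∈ ψ.source) (hψ₁ : ψ 1 = 0) {U : Set G}
    (hU : U ∈ 𝓝 1) : ∀ᶠ r in 𝓝 0, chartBall ψ r ⊆ U := by
  have preimage_mem : ψ.symm ⁻¹' U ∈ 𝓝 0 := by
    rw [← hψ₁]
    exact (ψ.continuousAt_symm (ψ.map_source hsource)).preimage_mem_nhds
      (by rwa [ψ.left_inv hsource])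
  filter_upwards [eventually_closedBall_subset preimage_mem] with r hr g hg
  simpa [ψ.left_inv hg.1] using hr hg.2

theorem eventually_nearlyAdditive_chartBall {𝕜 : Type*} [NontriviallyNormedField 𝕜]
    [NormedSpace 𝕜 E] (hsource : 1 ∈ ψ.source) (hψ₁ : ψ 1 = 0)
    (hderiv : HasStrictFDerivAt (fun z : E × E ↦ ψ (ψ.symm z.1 * ψ.symm z.2))
      (ContinuousLinearMap.fst 𝕜 E E + ContinuousLinearMap.snd 𝕜 E E) 0)
    {ε : ℝ} (hε : 0 < ε) : ∀ᶠ r in 𝓝[>] 0, NearlyAdditive ψ (chartBall ψ r) ε := by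
  lift ε to NNReal using hε.le
  obtain ⟨s, hs, approx⟩ := hderiv.approximates_deriv_on_nhds (Or.inr (NNReal.coe_pos.1 hε))
  filter_upwards [nhdsWithin_le_nhds (eventually_closedBall_subset hs), self_mem_nhdsWithin]
    with r hrs hr
  have pair_mem {x y : G} (hx : x ∈ chartBall ψ r) (hy : y ∈ chartBall ψ r) :
      (ψ x, ψ y) ∈ s := by
    refine hrs ?_
    rw [← Prod.mk_zero_zero, ← closedBall_prod_same]
    exact ⟨hx.2, hy.2⟩
  refine ⟨mem_of_mem_nhds (chartBall_mem_nhds_one hsource hψ₁ hr), hψ₁,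
    fun x hx y hy x' hx' y' hy' ↦ ?_⟩
  simpa [ψ.left_inv hx.1, ψ.left_inv hy.1, ψ.left_inv hx'.1, ψ.left_inv hy'.1, Prod.norm_def]
    using approx _ (pair_mem hx hy) _ (pair_mem hx' hy')

theorem eventually_exists_subgroup_coe_eq_chartBall [IsTopologicalGroup G] [IsUltrametricDist E]
    (hsource : 1 ∈ ψ.source) {r₀ ε : ℝ} (hr₀ : 0 < r₀)
    (hψ : NearlyAdditive ψ (chartBall ψ r₀) ε) (hε : ε ≤ 1) :
    ∀ᶠ r in 𝓝[>] 0, ∃ K : Subgroup G, (K : Set G) = chartBall ψ r := by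
  obtain ⟨V, hVo, hV₁, hV⟩ := exists_open_nhds_one_mul_subset (ψ.open_source.mem_nhds hsource)
  have ball₀_mem := chartBall_mem_nhds_one hsource hψ.map_one hr₀
  have small {U : Set G} (hU : U ∈ 𝓝 1) : ∀ᶠ r in 𝓝[>] 0, chartBall ψ r ⊆ U :=
    nhdsWithin_le_nhds (eventually_chartBall_subset hsource hψ.map_one hU)
  filter_upwards [small ball₀_mem, small (inv_mem_nhds_one G ball₀_mem),
    small (hVo.mem_nhds hV₁), self_mem_nhdsWithin] with r hr hr_inv hrV hr_pos
  refine ⟨{ carrier := chartBall ψ r, mul_mem' := fun {x y} hx hy ↦ ?_,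
            one_mem' := mem_of_mem_nhds (chartBall_mem_nhds_one hsource hψ.map_one hr_pos),
            inv_mem' := fun {x} hx ↦ ?_ }, rfl⟩
  · exact mem_chartBall.2 ⟨hV (Set.mul_mem_mul (hrV hx) (hrV hy)),
      hψ.norm_mul_le hε (hr hx) (hr hy) (mem_chartBall.1 hx).2 (mem_chartBall.1 hy).2⟩
  · have hx' : x⁻¹ ∈ chartBall ψ r₀ := hr_inv hx
    exact mem_chartBall.2 ⟨hx'.1,
      (hψ.norm_inv_le hε (hr hx) hx').trans (mem_chartBall.1 hx).2⟩

theorem exists_subgroup_nearlyAdditive [IsTopologicalGroup G] [IsUltrametricDist E]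
    {𝕜 : Type*} [NontriviallyNormedField 𝕜] [NormedSpace 𝕜 E] (hsource : 1 ∈ ψ.source)
    (hψ₁ : ψ 1 = 0)
    (hderiv : HasStrictFDerivAt (fun z : E × E ↦ ψ (ψ.symm z.1 * ψ.symm z.2))
      (ContinuousLinearMap.fst 𝕜 E E + ContinuousLinearMap.snd 𝕜 E E) 0)
    {ε : ℝ} (hε₀ : 0 < ε) (hε : ε ≤ 1) {U : Set G} (hU : U ∈ 𝓝 1) :
    ∃ r > 0, ∃ K : Subgroup G, (K : Set G) = chartBall ψ r ∧ closedBall 0 r ⊆ ψ.target ∧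
      (K : Set G) ⊆ U ∧ NearlyAdditive ψ K ε := by
  have nearlyAdditive := eventually_nearlyAdditive_chartBall hsource hψ₁ hderiv hε₀
  have htarget : ψ.target ∈ 𝓝 0 := ψ.open_target.mem_nhds (hψ₁ ▸ ψ.map_source hsource)
  obtain ⟨r₀, hψr₀, hr₀⟩ := (nearlyAdditive.and self_mem_nhdsWithin).exists
  obtain ⟨r, ⟨⟨⟨⟨K, hK⟩, hψr⟩, hrU⟩, hrt⟩, hr⟩ :=
    ((((eventually_exists_subgroup_coe_eq_chartBall hsource hr₀ hψr₀ hε).and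
      nearlyAdditive).and (nhdsWithin_le_nhds (eventually_chartBall_subset hsource hψ₁ hU))).and
        (nhdsWithin_le_nhds (eventually_closedBall_subset htarget))).and
          self_mem_nhdsWithin |>.exists
  exact ⟨r, hr, K, hK, hrt, hK ▸ hrU, hK ▸ hψr⟩

end ChartBall

section OpenSubgroup

variable {ι G : Type*} [Group G] [TopologicalSpace G] [IsTopologicalGroup G]
  {Z : Subgroup G}

theorem exists_forall_topologicalClosure_zpowers_pow_le [Finite ι] {x : ι → G}
    (hx : ∀ i, ∃ n : ℕ, 0 < n ∧ (Subgroup.zpowers (x i ^ n)).topologicalClosure ≤ Z) :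
    ∃ N : ℕ, 0 < N ∧ ∀ i, (Subgroup.zpowers (x i ^ N)).topologicalClosure ≤ Z := by
  have := Fintype.ofFinite ι
  choose n hn hnZ using hx
  refine ⟨∏ i, n i, Finset.prod_pos fun i _ ↦ hn i, fun i ↦ ?_⟩
  obtain ⟨l, hl⟩ := Finset.dvd_prod_of_mem n (Finset.mem_univ i)
  rw [hl, pow_mul]
  exact (Subgroup.topologicalClosure_mono
    (Subgroup.zpowers_le.2 (Subgroup.npow_mem_zpowers _ l))).trans (hnZ i)

variable [Fintype ι] {p : ℕ} [Fact p.Prime]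

theorem NearlyAdditive.mem_of_norm_le [T2Space G] [DecidableEq ι] {ψ : G → ι → ℚ_[p]}
    {K : Subgroup G} (hψ : NearlyAdditive ψ K ((p : ℝ)⁻¹ ^ 2)) (hKc : IsCompact (K : Set G))
    (hcont : ContinuousOn ψ K) (hinj : Set.InjOn ψ K) {x : ι → G} (hx : ∀ i, x i ∈ K)
    {b : ℚ_[p]} (hb : b ≠ 0) (hψx : ∀ i, ψ (x i) = Pi.single i b) {N : ℕ}
    (hNZ : ∀ i, (Subgroup.zpowers (x i ^ N)).topologicalClosure ≤ Z) {g : G} (hg : g ∈ K)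
    (hgN : ‖ψ g‖ ≤ ‖(N : ℚ_[p])‖ * ‖b‖) : g ∈ Z := by
  let C (i : ι) : Subgroup G := (Subgroup.zpowers (x i ^ N)).topologicalClosure
  have hCK (i : ι) : C i ≤ K :=
    topologicalClosure_zpowers_le (K.pow_mem (hx i) N) hKc.isClosed
  have approx (i : ι) (a : ℚ_[p]) (ha : ‖a‖ ≤ ‖(N : ℚ_[p])‖ * ‖b‖) :
      ∃ v ∈ C i, ‖ψ v - Pi.single i a‖ ≤ (p : ℝ)⁻¹ * ‖a‖ := by
    obtain ⟨v, hv, hva⟩ := hψ.exists_mem_zpowers_norm_sub_single_le (hx i) hb (hψx i) ha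
    exact ⟨v, Subgroup.le_topologicalClosure _ hv, hva⟩
  have hp₁ : (p : ℝ)⁻¹ < 1 := inv_lt_one_of_one_lt₀ (mod_cast (Fact.out : p.Prime).one_lt)
  have hψ' : NearlyAdditive ψ K (p : ℝ)⁻¹ :=
    hψ.mono (pow_le_of_le_one (by positivity) hp₁.le two_ne_zero)
  obtain ⟨c, hc, hcg⟩ := hψ'.exists_map_orderedProd_eq (by positivity) hp₁ hcont hCK
    (fun i ↦ hKc.of_isClosed_subset isClosed_closure (hCK i)) approx hgN
  rw [← hinj (orderedProd_mem fun i ↦ hCK i (hc i)) hg hcg]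
  exact orderedProd_mem fun i ↦ hNZ i (hc i)

theorem NearlyAdditive.isOpen_of_forall_exists_topologicalClosure_zpowers_le [T2Space G]
    {ψ : OpenPartialHomeomorph G (ι → ℚ_[p])} {K : Subgroup G} {r : ℝ}
    (hψ : NearlyAdditive ψ K ((p : ℝ)⁻¹ ^ 2)) (hK : (K : Set G) = chartBall ψ r) (hr : 0 < r)
    (htarget : closedBall 0 r ⊆ ψ.target)
    (hZ : ∀ x ∈ K, ∃ n : ℕ, 0 < n ∧ (Subgroup.zpowers (x ^ n)).topologicalClosure ≤ Z) :
    IsOpen (Z : Set G) := by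
  classical
  have hKc : IsCompact (K : Set G) := hK ▸ isCompact_chartBall htarget
  have hKsource : (K : Set G) ⊆ ψ.source := hK ▸ Set.inter_subset_left
  obtain ⟨b, hb, hbr⟩ := NormedField.exists_norm_lt ℚ_[p] hr
  have norm_single_le (i : ι) : ‖(Pi.single i b : ι → ℚ_[p])‖ ≤ r := by
    rw [Pi.norm_single]
    exact hbr.le
  let x (i : ι) : G := ψ.symm (Pi.single i b)
  have hxK (i : ι) : x i ∈ K := hK.ge (symm_mem_chartBall htarget (norm_single_le i))
  have hψx (i : ι) : ψ (x i) = Pi.single i b :=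
    ψ.right_inv (htarget (mem_closedBall_zero_iff.2 (norm_single_le i)))
  obtain ⟨N, hN, hNZ⟩ := exists_forall_topologicalClosure_zpowers_pow_le fun i ↦ hZ _ (hxK i)
  have hR : 0 < ‖(N : ℚ_[p])‖ * ‖b‖ := mul_pos (norm_pos_iff.2 (mod_cast hN.ne')) hb
  have ball_mem {R : ℝ} (hR : 0 < R) : chartBall ψ R ∈ 𝓝 1 :=
    chartBall_mem_nhds_one (hKsource hψ.one_mem) hψ.map_one hR
  refine Subgroup.isOpen_of_mem_nhds Z (Filter.mem_of_superset
    (Filter.inter_mem (ball_mem hr) (ball_mem hR)) fun g hg ↦ ?_)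
  exact hψ.mem_of_norm_le hKc (ψ.continuousOn.mono hKsource) (ψ.injOn.mono hKsource) hxK
    (norm_pos_iff.1 hb) hψx hNZ (hK.ge hg.1) (mem_chartBall.1 hg.2).2

theorem isOpen_of_forall_exists_topologicalClosure_zpowers_le
    [ChartedSpace (ι → ℚ_[p]) G] [LieGroup 𝓘(ℚ_[p], ι → ℚ_[p]) ω G] {U : Set G} (hU : U ∈ 𝓝 1)
    (hZ : ∀ x ∈ U, ∃ n : ℕ, 0 < n ∧ (Subgroup.zpowers (x ^ n)).topologicalClosure ≤ Z) :
    IsOpen (Z : Set G) := by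
  have : T1Space G := ChartedSpace.t1Space (ι → ℚ_[p]) G
  have : IsManifold 𝓘(ℚ_[p], ι → ℚ_[p]) ω G := inferInstance
  have hp : 0 < (p : ℝ)⁻¹ := inv_pos.2 (mod_cast (Fact.out : p.Prime).pos)
  obtain ⟨ψ, hatlas, hsource, hψ₁⟩ :=
    exists_mem_maximalAtlas_map_eq_zero (𝕜 := ℚ_[p]) (E := ι → ℚ_[p]) (n := ω) (1 : G)
  obtain ⟨r, hr, K, hK, htarget, hKU, hψ⟩ := exists_subgroup_nearlyAdditive hsource hψ₁
    (hasStrictFDerivAt_mul_of_mem_maximalAtlas hatlas hsource hψ₁) (pow_pos hp 2)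
    (pow_le_one₀ hp.le (Nat.cast_inv_le_one p)) hU
  exact hψ.isOpen_of_forall_exists_topologicalClosure_zpowers_le hK hr htarget
    fun x hx ↦ hZ x (hKU hx)

end OpenSubgroup

theorem isOpen_vectorStabilizer_of_isOpen_vectorStabilizer_map
    {p : ℕ} [Fact p.Prime] {d : ℕ}
    {G : Type*} [Group G] [TopologicalSpace G] [IsTopologicalGroup G]
    [ChartedSpace (Fin d → ℚ_[p]) G] [LieGroup 𝓘(ℚ_[p], Fin d → ℚ_[p]) ω G]
    {k V W : Type*} [CommRing k] [AddCommGroup V] [Module k V] [AddCommGroup W] [Module k W]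
    {ρ : Representation k G V} {σ : Representation k G W}
    {f : Representation.IntertwiningMap ρ σ} {m : ℕ} (hm : 0 < m)
    (htors : ∀ v, f v = 0 → m • v = 0) (hker : f.ker.toRepresentation.IsSmooth) {v : V}
    (hv : IsOpen (vectorStabilizer σ (f v) : Set G)) :
    IsOpen (vectorStabilizer ρ v : Set G) := by
  have : T1Space G := ChartedSpace.t1Space (Fin d → ℚ_[p]) G
  obtain ⟨K, hKo, hKc⟩ := LieGroup.exists_isOpen_isCompact_subgroup (p := p) (d := d) (G := G)
  let H : Subgroup G := K ⊓ vectorStabilizer σ (f v)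
  have hHc : IsCompact (H : Set G) := hKc.inter_right (Subgroup.isClosed_of_isOpen _ hv)
  have hH : (H : Set G) ∈ 𝓝 1 := (hKo.inter hv).mem_nhds H.one_mem
  have map_eq_zero {g : G} (hg : g ∈ H) : f (ρ g v - v) = 0 := map_apply_sub_eq_zero f hg.2
  exact isOpen_of_forall_exists_topologicalClosure_zpowers_le (p := p) (ι := Fin d) hH fun x hx ↦
    exists_topologicalClosure_zpowers_pow_le_vectorStabilizer hm hHc
      (fun g hg ↦ isOpen_vectorStabilizer_of_mem hker (map_eq_zero hg))
      (fun g hg ↦ htors _ (map_eq_zero hg)) hx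

theorem corollary4p2_general
    {p : ℕ} [Fact p.Prime] {d : ℕ}
    {G : Type*} [Group G] [TopologicalSpace G] [IsTopologicalGroup G]
    [ChartedSpace (Fin d → ℚ_[p]) G] [LieGroup 𝓘(ℚ_[p], Fin d → ℚ_[p]) ω G]
    {k : Type*} [CommRing k] {m : ℕ} (hm : 0 < m)
    {V W : Type*} [AddCommGroup V] [Module k V] [AddCommGroup W] [Module k W]
    {ρ : Representation k G V} {σ : Representation k G W}
    (f : Representation.IntertwiningMap ρ σ)
    (hf : Function.Surjective f)
    (hker : f.ker.toRepresentation.IsSmooth)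
    (htors : ∀ v, f v = 0 → m • v = 0) :
    Function.Surjective f.smoothMap := by
  have hG := LieGroup.exists_isOpen_isCompact_subgroup (p := p) (d := d) (G := G)
  rintro ⟨w, hw⟩
  obtain ⟨v, rfl⟩ := hf w
  have hv : IsOpen (vectorStabilizer ρ v : Set G) :=
    isOpen_vectorStabilizer_of_isOpen_vectorStabilizer_map (p := p) (d := d) hm htors hker
      ((mem_smoothPart_iff_isOpen_vectorStabilizer hG).1 hw)
  exact ⟨⟨v, (mem_smoothPart_iff_isOpen_vectorStabilizer hG).2 hv⟩, rfl⟩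

theorem corollary4p2
    {p : ℕ} [Fact p.Prime] {d : ℕ}
    {G : Type*} [Group G] [TopologicalSpace G] [IsTopologicalGroup G]
    [ChartedSpace (Fin d → ℚ_[p]) G] [LieGroup 𝓘(ℚ_[p], Fin d → ℚ_[p]) ω G]
    {k : Type*} [Field k] {m : ℕ} [CharP k m] (hm : 0 < m)
    {V W : Type*} [AddCommGroup V] [Module k V] [AddCommGroup W] [Module k W]
    {ρ : Representation k G V} {σ : Representation k G W}
    (f : Representation.IntertwiningMap ρ σ)
    (hf : Function.Surjective f)
    (hker : f.ker.toRepresentation.IsSmooth) :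
    Function.Surjective f.smoothMap :=
  corollary4p2_general (p := p) (d := d) hm f hf hker fun v _ ↦ by
    rw [← Nat.cast_smul_eq_nsmul k, CharP.cast_eq_zero, zero_smul]
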